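/- Let $A$ be an abelian variety over $\mathbb{C}$, let $C\subset A$ be an irreducible Zariski closed subvariety of dimension $1$, and let $m\ge 2$ be an integer. Let $D_m\colon A^{m+1}\to A^m$ be the morphism given by $$D_m(P_0,P_1,\ldots,P_m)=(P_1-P_0,\ldots,P_m-P_0),$$ and set $X=D_m(C^{m+1})\subset A^m$. Let $\mathrm{Stab}(X)$ be the algebraic subgroup of $A^m$ determined by $\{P\in A^m(\mathbb{C}) : P+X=X\}$. If $B$ is an abelian subvariety of $A$ with $B^m\subset \mathrm{Stab}(X)$, then $B=0$ or $C$ is a translate of $B$, that is, $C=P+B$ for some $P\in A(\mathbb{C})$. -/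

import Mathlib

open CategoryTheory Limits AlgebraicGeometry MonoidalCategory CartesianMonoidalCategory MonObj

noncomputable section

namespace FaltingsZhang

/-- The category of schemes over `ℂ`; its monoidal product is the fibre product over `Spec ℂ` and
its unit object `𝟙_ SchC` is `Spec ℂ`. A morphism `𝟙_ SchC ⟶ Y` is a complex point of `Y`. -/
abbrev SchC : Type 1 := Over (Spec (.of ℂ))

/-- A complex abelian variety: a group scheme over `ℂ` that is proper and geometrically integral
over `ℂ`. (Smoothness and commutativity are automatic.) -/
class IsAbelianVariety (A : SchC) [GrpObj A] : Prop where
  isProper : IsProper A.hom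
  geometricallyIntegral : GeometricallyIntegral A.hom

attribute [instance] IsAbelianVariety.isProper IsAbelianVariety.geometricallyIntegral

/-- The `n`-fold power `Y ^ n`, i.e. the `n`-fold fibre product over `ℂ`. -/
abbrev power (Y : SchC) (n : ℕ) : SchC := ∏ᶜ fun _ : Fin n => Y

/-- The projection of `Y ^ n` to its `i`-th factor. -/
abbrev proj (Y : SchC) {n : ℕ} (i : Fin n) : power Y n ⟶ Y := Pi.π (fun _ : Fin n => Y) i

/-- The power `f ^ n : Y ^ n ⟶ Z ^ n` of a morphism `f : Y ⟶ Z`. -/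
abbrev powerMap {Y Z : SchC} (f : Y ⟶ Z) (n : ℕ) : power Y n ⟶ power Z n :=
  Pi.lift fun i => proj Y i ≫ f

theorem power_hom_ext {T Y : SchC} {n : ℕ} {f g : T ⟶ power Y n}
    (h : ∀ i : Fin n, f ≫ proj Y i = g ≫ proj Y i) : f = g :=
  Pi.hom_ext _ _ h

/-- The componentwise group structure on `G ^ n`. -/
instance powerGrpObj (G : SchC) [GrpObj G] (n : ℕ) : GrpObj (power G n) where
  one := Pi.lift fun _ => η[G]
  mul := Pi.lift fun i => (proj G i ⊗ₘ proj G i) ≫ μ[G]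
  inv := Pi.lift fun i => proj G i ≫ ι[G]
  one_mul := by
    refine power_hom_ext fun i => ?_
    simp [← tensorHom_id]
  mul_one := by
    refine power_hom_ext fun i => ?_
    simp [← id_tensorHom]
  mul_assoc := by
    refine power_hom_ext fun i => ?_
    have h1 : ((proj G i ⊗ₘ proj G i) ≫ μ[G]) ⊗ₘ proj G i =
        ((proj G i ⊗ₘ proj G i) ⊗ₘ proj G i) ≫ μ[G] ▷ G := by
      rw [← tensorHom_id, tensorHom_comp_tensorHom, Category.comp_id]
    have h2 : proj G i ⊗ₘ ((proj G i ⊗ₘ proj G i) ≫ μ[G]) =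
        (proj G i ⊗ₘ (proj G i ⊗ₘ proj G i)) ≫ G ◁ μ[G] := by
      rw [← id_tensorHom, tensorHom_comp_tensorHom, Category.comp_id]
    simp only [← tensorHom_id, ← id_tensorHom, Category.assoc, limit.lift_π, Fan.mk_pt,
      Fan.mk_π_app, tensorHom_comp_tensorHom_assoc, Category.id_comp]
    rw [h1, h2]
    simp only [Category.assoc]
    rw [MonObj.mul_assoc, associator_naturality_assoc]
  left_inv := by
    refine power_hom_ext fun i => ?_
    simp
  right_inv := by
    refine power_hom_ext fun i => ?_
    simp

/-- Translation by a complex point `P` of a group scheme `G`: on points, `x ↦ P + x`. (The group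
law on `T`-valued points `T ⟶ G` is written multiplicatively in Mathlib.) -/
def translation {G : SchC} [GrpObj G] (P : 𝟙_ SchC ⟶ G) : G ⟶ G := (toUnit G ≫ P) * 𝟙 G

/-- The translate `P + X` of a set `X` of points of the underlying scheme of `G`. -/
def translateSet {G : SchC} [GrpObj G] (P : 𝟙_ SchC ⟶ G) (X : Set G.left) : Set G.left :=
  (translation P).left '' X

theorem translation_one {G : SchC} [GrpObj G] : translation (1 : 𝟙_ SchC ⟶ G) = 𝟙 G := by
  simp [translation, MonObj.comp_one]

theorem translation_mul {G : SchC} [GrpObj G] (P Q : 𝟙_ SchC ⟶ G) :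
    translation (P * Q) = translation Q ≫ translation P := by
  simp [translation, MonObj.comp_mul, _root_.mul_assoc]

theorem translateSet_one {G : SchC} [GrpObj G] (X : Set G.left) :
    translateSet (1 : 𝟙_ SchC ⟶ G) X = X := by
  simp [translateSet, translation_one]

theorem translateSet_mul {G : SchC} [GrpObj G] (P Q : 𝟙_ SchC ⟶ G) (X : Set G.left) :
    translateSet (P * Q) X = translateSet P (translateSet Q X) := by
  simp [translateSet, translation_mul, Set.image_image]

/-- The stabilizer of `X ⊆ G`, given by its group of complex points
`{P ∈ G(ℂ) | P + X = X}`. -/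
def stab {G : SchC} [GrpObj G] (X : Set G.left) : Subgroup (𝟙_ SchC ⟶ G) where
  carrier := {P | translateSet P X = X}
  one_mem' := translateSet_one X
  mul_mem' := fun {P Q} hP hQ => by
    change translateSet (P * Q) X = X
    rw [translateSet_mul, show translateSet Q X = X from hQ, show translateSet P X = X from hP]
  inv_mem' := fun {P} hP => by
    change translateSet P⁻¹ X = X
    conv_lhs => rw [← show translateSet P X = X from hP]
    rw [← translateSet_mul, inv_mul_cancel, translateSet_one]

/-- The Faltings-Zhang morphism `D_m : A ^ (m + 1) ⟶ A ^ m`,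
`(P_0, …, P_m) ↦ (P_1 - P_0, …, P_m - P_0)`. -/
def faltingsZhang (A : SchC) [GrpObj A] (m : ℕ) : power A (m + 1) ⟶ power A m :=
  Pi.lift fun i : Fin m => proj A i.succ / proj A (0 : Fin (m + 1))

/-- For a Zariski closed `C ⊆ Y`, the Zariski closed subset `C ^ n` of `Y ^ n`: the points all of
whose projections lie in `C`. -/
def powerSubset {Y : SchC} (C : Set Y.left) (n : ℕ) : Set (power Y n).left :=
  ⋂ i : Fin n, (proj Y i).left ⁻¹' C

/-- The Faltings-Zhang image `X = D_m(C ^ (m + 1)) ⊆ A ^ m`. -/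
def faltingsZhangImage {A : SchC} [GrpObj A] (C : Set A.left) (m : ℕ) : Set (power A m).left :=
  (faltingsZhang A m).left '' powerSubset C (m + 1)

end FaltingsZhang

end

open TopologicalSpace in
theorem subsingleton_or_eq_of_topologicalKrullDim_le_one {Y : Type*} [TopologicalSpace Y] [T0Space Y]
    {C : Set Y} (hC : IsClosed C) (hCirr : IsIrreducible C) (hdim : topologicalKrullDim C ≤ 1)
    {Z : Set Y} (hZ : IsClosed Z) (hZirr : IsIrreducible Z) (hZC : Z ⊆ C) :
    Z.Subsingleton ∨ Z = C := by
  have key : ∀ W : Set Y, W ⊆ C → IsIrreducible W → IsIrreducible ((↑) ⁻¹' W : Set C) := by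
    intro W hWC hW
    refine ⟨hW.1.elim fun w hw => ⟨⟨w, hWC hw⟩, hw⟩, ?_⟩
    rintro _ _ ⟨u, hu, rfl⟩ ⟨v, hv, rfl⟩ ⟨x, hxW, hx⟩ ⟨y, hyW, hy⟩
    obtain ⟨w, hwW, hw⟩ := hW.2 u v hu hv ⟨x, hxW, hx⟩ ⟨y, hyW, hy⟩
    exact ⟨⟨w, hWC hwW⟩, hwW, hw⟩
  let z : IrreducibleCloseds C := ⟨_, key Z hZC hZirr, hZ.preimage continuous_subtype_val⟩
  let c : IrreducibleCloseds C := ⟨_, key C le_rfl hCirr, hC.preimage continuous_subtype_val⟩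
  -- In a poset of Krull dimension at most one, every element is minimal or maximal. If `Z` is
  -- minimal, each of its points is dense in it, so T0 leaves a single point.
  rcases Order.krullDim_le_one_iff.1 hdim z with h | h
  · left
    have hsub : ∀ x ∈ Z, ∀ y ∈ Z, x ⤳ y := by
      intro x hx y hy
      have hxC : closure {x} ⊆ Z := closure_minimal (by simpa using hx) hZ
      let w : IrreducibleCloseds C :=
        ⟨_, key (closure {x}) (hxC.trans hZC) isIrreducible_singleton.closure,
          isClosed_closure.preimage continuous_subtype_val⟩
      have hw : w ≤ z := fun a ha => hxC ha
      exact specializes_iff_mem_closure.2 (h hw (show (⟨y, hZC hy⟩ : C) ∈ z from hy))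
    exact fun x hx y hy => (hsub x hx y hy).antisymm (hsub y hy x hx) |>.eq
  · right
    have hz : z ≤ c := fun a _ => a.2
    exact hZC.antisymm fun x hx => h hz (show (⟨x, hx⟩ : C) ∈ c from hx)

-- `Z` is a finite union of irreducible closed sets; none is `C`, so each is at most a point.
open TopologicalSpace in
theorem finite_of_isClosed_of_topologicalKrullDim_le_one {Y : Type*} [TopologicalSpace Y]
    [T0Space Y] [NoetherianSpace Y] {C : Set Y} (hC : IsClosed C) (hCirr : IsIrreducible C)
    (hdim : topologicalKrullDim C ≤ 1) {Z : Set Y} (hZ : IsClosed Z) (hZC : Z ⊂ C) : Z.Finite := by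
  obtain ⟨S, hS, hScl, hSirr, rfl⟩ := NoetherianSpace.exists_finite_set_isClosed_irreducible hZ
  refine hS.sUnion fun t ht => ?_
  have htZ := Set.subset_sUnion_of_mem ht
  rcases subsingleton_or_eq_of_topologicalKrullDim_le_one hC hCirr hdim (hScl t ht) (hSirr t ht)
    (htZ.trans hZC.1) with h | h
  · exact h.finite
  · exact (hZC.2 (h ▸ htZ)).elim

noncomputable section

namespace FaltingsZhang

/-- The point of the underlying scheme given by a complex point. -/
def pt {Y : SchC} (P : 𝟙_ SchC ⟶ Y) : Y.left := P.left (IsLocalRing.closedPoint ℂ)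

theorem pt_comp {Y Z : SchC} (P : 𝟙_ SchC ⟶ Y) (f : Y ⟶ Z) : pt (P ≫ f) = f.left (pt P) :=
  Scheme.Hom.comp_apply P.left f.left _

theorem pt_injective {Y : SchC} [LocallyOfFiniteType Y.hom] :
    Function.Injective (pt : (𝟙_ SchC ⟶ Y) → Y.left) := by
  intro P Q h
  ext1
  exact ext_of_apply_closedPoint_eq Y.hom (Over.w P) (Over.w Q) h

theorem isClosed_pt {Y : SchC} [LocallyOfFiniteType Y.hom] (P : 𝟙_ SchC ⟶ Y) :
    IsClosed {pt P} :=
  (pointEquivClosedPoint Y.hom ⟨P.left, Over.w P⟩).2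

theorem jacobsonSpace (Y : SchC) [LocallyOfFiniteType Y.hom] : JacobsonSpace Y.left :=
  LocallyOfFiniteType.jacobsonSpace (Y := Spec (.of ℂ)) Y.hom

theorem exists_pt_eq {Y : SchC} [LocallyOfFiniteType Y.hom] {y : Y.left} (hy : IsClosed {y}) :
    ∃ P : 𝟙_ SchC ⟶ Y, pt P = y :=
  ⟨Over.homMk (pointOfClosedPoint Y.hom y hy) (by simp),
    pointOfClosedPoint_apply _ _ _ _⟩

theorem exists_pt_mem {Y : SchC} [LocallyOfFiniteType Y.hom] {Z : Set Y.left} (hZ : IsClosed Z)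
    (hne : Z.Nonempty) : ∃ P : 𝟙_ SchC ⟶ Y, pt P ∈ Z := by
  have := jacobsonSpace Y
  obtain ⟨y, hyZ, hy⟩ := nonempty_inter_closedPoints hne hZ.isLocallyClosed
  obtain ⟨P, rfl⟩ := exists_pt_eq hy
  exact ⟨P, hyZ⟩

/-- Complex points are exactly the closed points, which are dense in a Jacobson space. -/
theorem eq_univ_of_forall_pt_mem {Y : SchC} [LocallyOfFiniteType Y.hom] {Z : Set Y.left}
    (hZ : IsClosed Z) (h : ∀ P : 𝟙_ SchC ⟶ Y, pt P ∈ Z) : Z = Set.univ := by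
  have := jacobsonSpace Y
  rw [← Set.univ_subset_iff, ← closure_closedPoints]
  refine closure_minimal (fun y hy => ?_) hZ
  obtain ⟨P, rfl⟩ := exists_pt_eq hy
  exact h P

theorem comp_translation {G : SchC} [GrpObj G] (P Q : 𝟙_ SchC ⟶ G) :
    Q ≫ translation P = P * Q := by
  have : Q ≫ toUnit G = 𝟙 _ := toUnit_unique _ _
  simp [translation, MonObj.comp_mul, reassoc_of% this]

theorem translation_isHomeomorph {G : SchC} [GrpObj G] (P : 𝟙_ SchC ⟶ G) :
    IsHomeomorph (translation P).left := by
  have : IsIso (translation P) := ⟨translation P⁻¹, by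
    rw [← translation_mul, inv_mul_cancel, translation_one], by
    rw [← translation_mul, mul_inv_cancel, translation_one]⟩
  have : IsIso (translation P).left := inferInstanceAs (IsIso ((Over.forget _).map (translation P)))
  exact (translation P).left.homeomorph.isHomeomorph

/-- The unit section is a surjective closed immersion into a reduced scheme. -/
theorem isIso_one_of_subsingleton {B : SchC} [GrpObj B] [IsAbelianVariety B]
    (h : Subsingleton B.left) : IsIso η[B] := by
  have : IsIntegral B.left := GeometricallyIntegral.isIntegral_of_subsingleton B.hom
  have : Surjective η[B].left := ⟨fun y => ⟨IsLocalRing.closedPoint ℂ, Subsingleton.elim _ _⟩⟩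
  have : IsIso η[B].left := isIso_of_isClosedImmersion_of_surjective _
  have : IsIso ((Over.forget _).map η[B]) := this
  exact isIso_of_reflects_iso η[B] (Over.forget _)

theorem comp_powerMap_proj {T Y Z : SchC} {n : ℕ} (f : Y ⟶ Z) (g : T ⟶ power Y n) (j : Fin n) :
    (g ≫ powerMap f n) ≫ proj Z j = (g ≫ proj Y j) ≫ f := by
  simp

theorem faltingsZhang_proj (A : SchC) [GrpObj A] (m : ℕ) (j : Fin m) :
    faltingsZhang A m ≫ proj A j = proj A j.succ / proj A (0 : Fin (m + 1)) := by
  simp [faltingsZhang]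

theorem pt_one_mem_faltingsZhangImage {A : SchC} [GrpObj A] {C : Set A.left}
    (m : ℕ) {c : 𝟙_ SchC ⟶ A} (hc : pt c ∈ C) :
    pt (1 : 𝟙_ SchC ⟶ power A m) ∈ faltingsZhangImage C m := by
  -- The diagonal point `(c, …, c)` maps to the origin.
  refine ⟨pt (Pi.lift fun _ => c), ?_, ?_⟩
  · refine Set.mem_iInter.2 fun j => ?_
    rw [Set.mem_preimage, ← pt_comp]
    simpa using hc
  · rw [← pt_comp]
    congr 1
    refine power_hom_ext fun j => ?_
    rw [Category.assoc, faltingsZhang_proj, GrpObj.comp_div]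
    have : (1 : 𝟙_ SchC ⟶ power A m) ≫ proj A j = 1 := by
      rw [Hom.one_def, Category.assoc]
      simp [MonObj.one, Hom.one_def]
    simp [this]

theorem pt_mem_faltingsZhangImage {A : SchC} [GrpObj A] {C : Set A.left}
    {m : ℕ} {c : 𝟙_ SchC ⟶ A} (hc : pt c ∈ C) {Q : 𝟙_ SchC ⟶ power A m}
    (hQ : Q ∈ stab (faltingsZhangImage C m)) : pt Q ∈ faltingsZhangImage C m := by
  have h : translateSet Q (faltingsZhangImage C m) = faltingsZhangImage C m := hQ
  rw [← h]
  refine ⟨_, pt_one_mem_faltingsZhangImage m hc, ?_⟩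
  rw [← pt_comp, comp_translation, _root_.mul_one]

/-- If a point `P` of `A ^ m` lies in `D_m(C ^ (m + 1))`, then any two of its coordinates are
differences of complex points of `C` with a common subtrahend. -/
theorem exists_pt_mem_of_mem_faltingsZhangImage {A : SchC} [GrpObj A] [IsProper A.hom]
    {C : Set A.left} (hC : IsClosed C) {m : ℕ} {P : 𝟙_ SchC ⟶ power A m}
    (hP : pt P ∈ faltingsZhangImage C m) (j k : Fin m) :
    ∃ c : 𝟙_ SchC ⟶ A, pt c ∈ C ∧ pt ((P ≫ proj A j) * c) ∈ C ∧ pt ((P ≫ proj A k) * c) ∈ C := by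
  obtain ⟨y, hy, hyP⟩ := hP
  have hy' (l : Fin (m + 1)) : (proj A l).left y ∈ C := Set.mem_iInter.1 hy l
  -- The preimage `y` need not be a closed point. Its image in `A × A × A` shows that the closed
  -- conditions required of `(c, c + P_j, c + P_k)` are consistent, so some complex point satisfies
  -- them all.
  let φ : power A (m + 1) ⟶ A ⊗ (A ⊗ A) :=
    lift (proj A 0) (lift (proj A j.succ) (proj A k.succ))
  let p : A ⊗ (A ⊗ A) ⟶ A := fst _ _
  let q : A ⊗ (A ⊗ A) ⟶ A := snd _ _ ≫ fst _ _
  let r : A ⊗ (A ⊗ A) ⟶ A := snd _ _ ≫ snd _ _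
  have hp : φ ≫ p = proj A 0 := by simp [φ, p]
  have hq : φ ≫ q = proj A j.succ := by simp [φ, q]
  have hr : φ ≫ r = proj A k.succ := by simp [φ, r]
  have happ (f : A ⊗ (A ⊗ A) ⟶ A) : f.left (φ.left y) = (φ ≫ f).left y :=
    (Scheme.Hom.comp_apply φ.left f.left y).symm
  have hdiff (l : Fin m) : (proj A l.succ / proj A 0).left y = pt (P ≫ proj A l) := by
    rw [← faltingsZhang_proj, pt_comp, ← hyP]
    exact Scheme.Hom.comp_apply _ _ y
  have : LocallyOfFiniteType (A ⊗ (A ⊗ A)).hom := by dsimp; infer_instance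
  obtain ⟨t, ⟨⟨⟨ht₁, ht₂⟩, ht₃⟩, ht₄⟩, ht₅⟩ := exists_pt_mem
    (((((hC.preimage p.left.continuous).inter (hC.preimage q.left.continuous)).inter
      (hC.preimage r.left.continuous)).inter
      ((isClosed_pt (P ≫ proj A j)).preimage (q / p).left.continuous)).inter
      ((isClosed_pt (P ≫ proj A k)).preimage (r / p).left.continuous))
    ⟨φ.left y, ⟨⟨⟨by simpa only [Set.mem_preimage, happ, hp] using hy' 0,
      by simpa only [Set.mem_preimage, happ, hq] using hy' _⟩,
      by simpa only [Set.mem_preimage, happ, hr] using hy' _⟩,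
      by simpa only [Set.mem_preimage, Set.mem_singleton_iff, happ, GrpObj.comp_div, hp, hq] using hdiff j⟩,
      by simpa only [Set.mem_preimage, Set.mem_singleton_iff, happ, GrpObj.comp_div, hp, hr] using hdiff k⟩
  rw [Set.mem_preimage, ← pt_comp] at ht₁ ht₂ ht₃ ht₄ ht₅
  have e₄ : (t ≫ q) / (t ≫ p) = P ≫ proj A j := by
    rw [← GrpObj.comp_div]; exact pt_injective ht₄
  have e₅ : (t ≫ r) / (t ≫ p) = P ≫ proj A k := by
    rw [← GrpObj.comp_div]; exact pt_injective ht₅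
  refine ⟨t ≫ p, ht₁, ?_, ?_⟩
  · rwa [← e₄, div_mul_cancel]
  · rwa [← e₅, div_mul_cancel]

theorem mul_comm_of_isAbelianVariety {A : SchC} [GrpObj A] [IsAbelianVariety A] {T : SchC}
    (P Q : T ⟶ A) : P * Q = Q * P := by
  have := isCommMonObj_of_isProper_of_geometricallyIntegral A
  exact _root_.mul_comm P Q

/-- If `C` is closed irreducible of dimension `1` and contains the translate by `c` of every complex
point of the abelian subvariety `B`, then `B = 0` or `C = c + B`. -/
theorem isIso_one_or_eq_translateSet {A : SchC} [GrpObj A] [IsAbelianVariety A]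
    {C : Set A.left} (hC : IsClosed C) (hCirr : IsIrreducible C) (hCdim : topologicalKrullDim C ≤ 1)
    {B : SchC} [GrpObj B] [IsAbelianVariety B] (i : B ⟶ A) [IsClosedImmersion i.left]
    (c : 𝟙_ SchC ⟶ A) (h : (i ≫ translation c).left ⁻¹' C = Set.univ) :
    IsIso η[B] ∨ ∃ P : 𝟙_ SchC ⟶ A, C = translateSet P (Set.range i.left) := by
  have : IsIntegral B.left := GeometricallyIntegral.isIntegral_of_subsingleton B.hom
  have hrange : translateSet c (Set.range i.left) = Set.range (i ≫ translation c).left := by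
    rw [translateSet, ← Set.range_comp]
    rfl
  have hsub : translateSet c (Set.range i.left) ⊆ C := by
    rwa [hrange, ← Set.preimage_eq_univ_iff]
  have hcl : IsClosed (translateSet c (Set.range i.left)) :=
    (translation_isHomeomorph c).isClosedMap _ i.left.isClosedEmbedding.isClosed_range
  have hirr : IsIrreducible (translateSet c (Set.range i.left)) := by
    rw [hrange, ← Set.image_univ]
    exact (IrreducibleSpace.isIrreducible_univ _).image _
      (i ≫ translation c).left.continuous.continuousOn
  rcases subsingleton_or_eq_of_topologicalKrullDim_le_one hC hCirr hCdim hcl hirr hsub with h' | h'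
  · left
    refine isIso_one_of_subsingleton ⟨fun x y => i.left.isClosedEmbedding.injective
      ((translation_isHomeomorph c).injective (h' ⟨_, ⟨x, rfl⟩, rfl⟩ ⟨_, ⟨y, rfl⟩, rfl⟩))⟩
  · exact Or.inr ⟨c, h'.symm⟩

theorem noetherianSpace (A : SchC) [IsProper A.hom] :
    TopologicalSpace.NoetherianSpace A.left := by
  have : IsLocallyNoetherian A.left :=
    LocallyOfFiniteType.isLocallyNoetherian (Y := Spec (.of ℂ)) A.hom
  have : CompactSpace A.left := QuasiCompact.compactSpace_of_compactSpace (Y := Spec (.of ℂ)) A.hom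
  have : IsNoetherian A.left := {}
  infer_instance

end FaltingsZhang

end

open FaltingsZhang in
theorem lemma5p2
    -- a complex abelian variety `A`
    (A : SchC) [GrpObj A] [IsAbelianVariety A]
    -- an irreducible closed subvariety `C` of `A` of dimension `1`
    (C : Set A.left) (hC : IsClosed C) (hCirr : IsIrreducible C) (hCdim : topologicalKrullDim C = 1)
    (m : ℕ) (hm : 2 ≤ m)
    -- an abelian subvariety `B` of `A`, with inclusion `i`
    (B : SchC) [GrpObj B] [IsAbelianVariety B] (i : B ⟶ A) [IsMonHom i] [IsClosedImmersion i.left]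
    -- `B ^ m ⊆ Stab(X)` on complex points
    (hB : ∀ Q : 𝟙_ SchC ⟶ power B m, Q ≫ powerMap i m ∈ stab (faltingsZhangImage C m)) :
    -- `B = 0`, or `C = P + B` for a complex point `P` of `A`
    IsIso η[B] ∨ ∃ P : 𝟙_ SchC ⟶ A, C = translateSet P (Set.range i.left) := by
  have := noetherianSpace A
  obtain ⟨c₀, hc₀⟩ := exists_pt_mem hC hCirr.1
  have key (b₁ b₂ : 𝟙_ SchC ⟶ B) :
      ∃ c : 𝟙_ SchC ⟶ A, pt c ∈ C ∧ pt ((b₁ ≫ i) * c) ∈ C ∧ pt ((b₂ ≫ i) * c) ∈ C := by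
    let j : Fin m := ⟨0, by omega⟩
    let k : Fin m := ⟨1, by omega⟩
    have hjk : k ≠ j := by simp [j, k]
    -- Only coordinates `j` and `k` matter; the remaining ones are filled with `b₂`.
    let Q : 𝟙_ SchC ⟶ power B m := Pi.lift fun l => if l = j then b₁ else b₂
    have hj : Q ≫ proj B j = b₁ := by simp [Q]
    have hk : Q ≫ proj B k = b₂ := by simp [Q, hjk]
    have := exists_pt_mem_of_mem_faltingsZhangImage hC
      (pt_mem_faltingsZhangImage hc₀ (hB Q)) j k
    rwa [comp_powerMap_proj, comp_powerMap_proj, hj, hk] at this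
  have comp_tr (c : 𝟙_ SchC ⟶ A) (b : 𝟙_ SchC ⟶ B) :
      (i ≫ translation c).left (pt b) = pt ((b ≫ i) * c) := by
    rw [← pt_comp, ← Category.assoc, comp_translation, mul_comm_of_isAbelianVariety]
  by_cases hstab : ∀ b : 𝟙_ SchC ⟶ B, C ⊆ (translation (b ≫ i)).left ⁻¹' C
  · refine isIso_one_or_eq_translateSet hC hCirr hCdim.le i c₀ (eq_univ_of_forall_pt_mem
      (hC.preimage (i ≫ translation c₀).left.continuous) fun b => ?_)
    rw [Set.mem_preimage, comp_tr, ← comp_translation, pt_comp]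
    exact hstab b hc₀
  · push Not at hstab
    obtain ⟨b₁, hb₁⟩ := hstab
    have hfin : (C ∩ (translation (b₁ ≫ i)).left ⁻¹' C).Finite :=
      finite_of_isClosed_of_topologicalKrullDim_le_one hC hCirr hCdim.le
        (hC.inter (hC.preimage (translation (b₁ ≫ i)).left.continuous))
        ⟨Set.inter_subset_left, fun h => hb₁ fun x hx => (h hx).2⟩
    let F : Set (𝟙_ SchC ⟶ A) := pt ⁻¹' (C ∩ (translation (b₁ ≫ i)).left ⁻¹' C)
    have hF : F.Finite := hfin.preimage pt_injective.injOn
    -- The traces on `B` of the sets `C - c`, for `c` in `F`.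
    let S : Set (Set B.left) := (fun c => (i ≫ translation c).left ⁻¹' C) '' F
    have hS : S.Finite := hF.image _
    have hScl : ∀ z ∈ S, IsClosed z := by
      rintro _ ⟨c, -, rfl⟩
      exact hC.preimage (i ≫ translation c).left.continuous
    have hcov : ⋃₀ S = Set.univ := by
      refine eq_univ_of_forall_pt_mem 
        (Set.sUnion_eq_biUnion ▸ hS.isClosed_biUnion hScl) fun b => ?_
      obtain ⟨c, hc, hc₁, hc₂⟩ := key b₁ b
      refine ⟨_, ⟨c, ⟨hc, ?_⟩, rfl⟩, ?_⟩
      · rwa [Set.mem_preimage, ← pt_comp, comp_translation]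
      · rwa [Set.mem_preimage, comp_tr]
    have : IsIntegral B.left := GeometricallyIntegral.isIntegral_of_subsingleton B.hom
    obtain ⟨z, hz, hzu⟩ := isIrreducible_iff_sUnion_isClosed.1
      (IrreducibleSpace.isIrreducible_univ B.left) hS.toFinset (by simpa using hScl)
      (by simp [hcov])
    obtain ⟨c, -, rfl⟩ := hS.mem_toFinset.1 hz
    exact isIso_one_or_eq_translateSet hC hCirr hCdim.le i c (Set.univ_subset_iff.1 hzu)
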